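/- A \emph{convergence} $\xi$ on a set $X$ is a relation $x\in\lim_\xi\mathcal F$ between points $x$ of $X$ and (proper) filters $\mathcal F$ on $X$ such that $x\in\lim_\xi\{x\}^{\uparrow}$ for all $x$, where $\{x\}^\uparrow$ is the principal ultrafilter at $x$, and $\lim_\xi\mathcal F\subseteq\lim_\xi\mathcal G$ whenever $\mathcal F\subseteq\mathcal G$. Write $\xi\ge\tau$ ($\xi$ is finer than $\tau$) if $\lim_\xi\mathcal F\subseteq\lim_\tau\mathcal F$ for all $\mathcal F$. A topology is regarded as the convergence in which $x\in\lim\mathcal F$ iff $\mathcal F$ contains the neighborhood filter of $x$. A set $O$ is $\xi$-open if $O\in\mathcal F$ whenever $\lim_\xi\mathcal F\cap O\neq\emptyset$; $T\xi$ denotes the topology of all $\xi$-open sets. A map $f$ is continuous if $x\in\lim\mathcal F$ implies $f(x)\in\lim f(\mathcal F)$. For convergence spaces $X,Y$ let $[X,Y]$ be the set $C(X,Y)$ of continuous maps with the continuous convergence: $f\in\lim_{[X,Y]}\mathcal F$ iff $f(x)\in\lim_Y e(\mathcal G\times\mathcal F)$ for all $x\in X$ and all filters $\mathcal G$ on $X$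 with $x\in\lim_X\mathcal G$, where $e(x,f)=f(x)$. Let $\$$ be the Sierpi\'nski space, so that $C(X,\$)$ is identified with the set $\mathcal O_X$ of open subsets of $X$. (If $X$ is topological, $T[X,\$]$ is $\mathcal O_X$ with the Scott topology.) A convergence space $X$ is \emph{epitopological} if it carries the initial convergence for the map $i:X\to[[X,\$],\$]$, $i(x)(f)=f(x)$; it is \emph{$T$-dual} if $[X,\$]=T[X,\$]$. Let $\operatorname{Epi}_TX$ be the set $X$ with the initial convergence for $i:X\to[T[X,\$],\$]$, $i(x)(f)=f(x)$. For an epitopological space $X$ put $\operatorname{Epi}_T^0X=X$ and $\operatorname{Epi}_T^\alpha X=\operatorname{Epi}_T\bigl(\bigvee_{\beta<\alpha}\operatorname{Epi}_T^\beta X\bigr)$ for ordinals $\alpha>0$, and let $d_TX$ be the value at which this increasing transfinite sequence becomes stationary; $d_TX$ is the coarsest $T$-dual epitopological convergence on the set $X$ that is finer than $X$. A topological space is \emph{core compact} if for every point $x$ and every open $O\ni x$ there is an open $U\ni x$ such that every open cover of $O$ has a finite subfamily that covers $U$. \textbf{Theorem.} Let $X$ be an epitopological convergence space with $X\ge T\,d_TX$.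 Then the topological space $T[X,\$]$ is core compact if and only if $X$ is a core compact topological space (that is, the convergence of $X$ is topological and core compact). -/

import Mathlib

open Filter Topology

universe u v w

/-- A convergence on `X`: a relation between filters and points, containing all `pure x → x` and
stable under passing to finer filters (in Mathlib's order, `G ≤ F` means that `G` is finer).
The degenerate filter `⊥` is finer than every `pure x`, hence it converges to every point; so
convergences in this sense are in canonical bijection with relations on proper filters only, and
`⊥` has no influence on any of the notions below. -/
@[ext] structure ConvStr (X : Type u) where
  /-- `Lim F x` means `x ∈ lim F`. -/
  Lim : Filter X → X → Prop
  lim_pure : ∀ x, Lim (pure x) x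
  lim_mono : ∀ {F G : Filter X} {x : X}, G ≤ F → Lim F x → Lim G x

namespace ConvStr

variable {X : Type u} {Y : Type v} {Z : Type w}

/-- `ξ ≤ τ` means that `τ` is finer than `ξ`: `lim_τ F ⊆ lim_ξ F` for all `F`. -/
instance : PartialOrder (ConvStr X) where
  le ξ τ := ∀ F x, τ.Lim F x → ξ.Lim F x
  le_refl _ _ _ h := h
  le_trans _ _ _ h₁ h₂ F x h := h₁ F x (h₂ F x h)
  le_antisymm ξ τ h₁ h₂ := by
    ext F x
    exact ⟨h₂ F x, h₁ F x⟩

/-- Suprema of convergences: `lim` for the supremum is the intersection of the `lim`s. -/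
instance : SupSet (ConvStr X) where
  sSup S :=
    { Lim := fun F x => ∀ ξ ∈ S, ξ.Lim F x
      lim_pure := fun x τ _ => τ.lim_pure x
      lim_mono := fun hGF h τ hτ => τ.lim_mono hGF (h τ hτ) }

instance : CompleteLattice (ConvStr X) :=
  completeLatticeOfSup _ fun _ =>
    ⟨fun _ hξ _ _ h => h _ hξ, fun _ hτ F x h _ hξ => hτ hξ F x h⟩

/-- The convergence of a topology: `F` converges to `x` if it is finer than `𝓝 x`. -/
def ofTop (t : TopologicalSpace X) : ConvStr X where
  Lim F x := F ≤ @nhds X t x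
  lim_pure x := @pure_le_nhds X t x
  lim_mono hGF h := hGF.trans h

/-- The topology of all `ξ`-open sets. -/
abbrev toTop (ξ : ConvStr X) : TopologicalSpace X where
  IsOpen O := ∀ F x, ξ.Lim F x → x ∈ O → O ∈ F
  isOpen_univ _ _ _ _ := univ_mem
  isOpen_inter O P hO hP F x h hx := inter_mem (hO F x h hx.1) (hP F x h hx.2)
  isOpen_sUnion S hS F x h := by
    rintro ⟨O, hOS, hx⟩
    exact mem_of_superset (hS O hOS F x h hx) (Set.subset_sUnion_of_mem hOS)

/-- The topological modification `T ξ`, regarded as a convergence. -/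
def T (ξ : ConvStr X) : ConvStr X := ofTop ξ.toTop

/-- Continuity of maps between convergence spaces. -/
def Cont (ξ : ConvStr X) (σ : ConvStr Y) (f : X → Y) : Prop :=
  ∀ F x, ξ.Lim F x → σ.Lim (map f F) (f x)

/-- The set `C(ξ, σ)` of continuous maps. -/
abbrev Maps (ξ : ConvStr X) (σ : ConvStr Y) : Type (max u v) := {f : X → Y // Cont ξ σ f}

/-- The continuous convergence `[ξ, σ]` on `C(ξ, σ)`. -/
def hom (ξ : ConvStr X) (σ : ConvStr Y) : ConvStr (Maps ξ σ) where
  Lim F f := ∀ (x : X) (G : Filter X), ξ.Lim G x →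
    σ.Lim (map (fun p : X × Maps ξ σ => p.2.1 p.1) (G ×ˢ F)) (f.1 x)
  lim_pure f x G hG := by
    rw [prod_pure, map_map]
    exact f.2 G x hG
  lim_mono hGF h x G hG := σ.lim_mono (map_mono (prod_mono le_rfl hGF)) (h x G hG)

/-- The initial convergence `f⁻ σ`: the coarsest one making `f` continuous. -/
def initial (f : X → Y) (σ : ConvStr Y) : ConvStr X where
  Lim F x := σ.Lim (map f F) (f x)
  lim_pure x := by
    rw [map_pure]
    exact σ.lim_pure _
  lim_mono hGF h := σ.lim_mono (map_mono hGF) h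

/-- The Sierpiński space `$`: Mathlib's `Prop`, whose open sets are `∅`, `{True}` and the whole
space. A set, viewed as a map to `Prop`, is continuous iff it is open. -/
def sierp : ConvStr Prop := ofTop inferInstance

/-- The dual `[ξ, $]`: the open subsets of `ξ` with the continuous convergence. -/
abbrev dual (ξ : ConvStr X) : ConvStr (Maps ξ sierp) := hom ξ sierp

theorem cont_T {ξ : ConvStr X} {t : TopologicalSpace Y} {f : X → Y} (hf : Cont ξ (ofTop t) f) :
    Cont (T ξ) (ofTop t) f := by
  intro F x hF
  refine (@le_nhds_iff Y t _ _).2 fun s hs ho => ?_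
  refine hF (@IsOpen.mem_nhds X ξ.toTop x _ ?_ hs)
  intro G y hG hy
  exact hf G y hG (@IsOpen.mem_nhds Y t _ _ ho hy)

theorem cont_eval (ξ : ConvStr X) (x : X) : Cont (dual ξ) sierp (fun f => f.1 x) := by
  intro F f hF
  have h := hF x (pure x) (ξ.lim_pure x)
  rwa [pure_prod, map_map] at h

/-- The canonical map `i : X → C([ξ, $], $)`, `i x f = f x`. -/
def bidualMap (ξ : ConvStr X) (x : X) : Maps (dual ξ) sierp :=
  ⟨fun f => f.1 x, cont_eval ξ x⟩

/-- The same map `i`, with values in `C(T[ξ, $], $)` (the same set of maps). -/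
def bidualMapT (ξ : ConvStr X) (x : X) : Maps (T (dual ξ)) sierp :=
  ⟨fun f => f.1 x, cont_T (cont_eval ξ x)⟩

/-- `Epi ξ = i⁻ [[ξ, $], $]`. -/
def Epi (ξ : ConvStr X) : ConvStr X := initial (bidualMap ξ) (dual (dual ξ))

/-- `Epi_T ξ = i⁻ [T[ξ, $], $]`. -/
def EpiT (ξ : ConvStr X) : ConvStr X := initial (bidualMapT ξ) (dual (T (dual ξ)))

/-- `ξ` is epitopological: `i : X → [[ξ, $], $]` is initial. -/
def IsEpitopological (ξ : ConvStr X) : Prop := ξ = Epi ξ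

/-- `ξ` is `T`-dual: `[ξ, $] = T[ξ, $]`. -/
def IsTDual (ξ : ConvStr X) : Prop := dual ξ = T (dual ξ)

/-- The transfinite iterates of `Epi_T`: `Epi_T^0 ξ = ξ` and, for `α > 0`,
`Epi_T^α ξ = Epi_T (⨆ β < α, Epi_T^β ξ)`; in particular `Epi_T^1 = Epi_T`. -/
noncomputable def iterEpiT (ξ : ConvStr X) (α : Ordinal.{u}) : ConvStr X :=
  open scoped Classical in
  if α = 0 then ξ else EpiT (⨆ β : Set.Iio α, iterEpiT ξ β.1)
termination_by α
decreasing_by exact β.2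

/-- `d_T ξ`: the value at which the transfinite iteration of `Epi_T` becomes stationary. (For an
epitopological `ξ` it does, and `d_T ξ` is the coarsest `T`-dual epitopology finer than `ξ`: see
`iterEpiT_stabilizes` and `isLeast_dT`.) -/
noncomputable def dT (ξ : ConvStr X) : ConvStr X :=
  iterEpiT ξ (sInf {α : Ordinal.{u} | iterEpiT ξ α = iterEpiT ξ (α + 1)})

theorem lim_EpiT {ξ : ConvStr X} {F : Filter X} {x : X} :
    (EpiT ξ).Lim F x ↔ ∀ (f : Maps ξ sierp) (G : Filter (Maps ξ sierp)), (T (dual ξ)).Lim G f →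
      sierp.Lim (map (fun p : Maps ξ sierp × X => p.1.1 p.2) (G ×ˢ F)) (f.1 x) := by
  refine forall_congr' fun f => forall_congr' fun G => imp_congr_right fun _ => ?_
  rw [← Filter.map_id (f := G), prod_map_map_eq, map_map, Filter.map_id]
  rfl

theorem lim_Epi {ξ : ConvStr X} {F : Filter X} {x : X} :
    (Epi ξ).Lim F x ↔ ∀ (f : Maps ξ sierp) (G : Filter (Maps ξ sierp)), (dual ξ).Lim G f →
      sierp.Lim (map (fun p : Maps ξ sierp × X => p.1.1 p.2) (G ×ˢ F)) (f.1 x) := by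
  refine forall_congr' fun f => forall_congr' fun G => imp_congr_right fun _ => ?_
  rw [← Filter.map_id (f := G), prod_map_map_eq, map_map, Filter.map_id]
  rfl

theorem T_le (ξ : ConvStr X) : T ξ ≤ ξ := fun F x h =>
  (@le_nhds_iff X ξ.toTop _ _).2 fun _ hs ho => ho F x h hs

theorem EpiT_mono {ξ τ : ConvStr X} (h : ξ ≤ τ) : EpiT ξ ≤ EpiT τ := by
  intro F x hF
  rw [lim_EpiT] at hF ⊢
  intro f G hG
  let j : Maps ξ sierp → Maps τ sierp := fun f => ⟨f.1, fun F x hF => f.2 F x (h F x hF)⟩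
  have hj : Cont (dual ξ) (dual τ) j := by
    intro H g hH y K hK
    have := hH y K (h K y hK)
    rw [show K = map id K from map_id.symm, prod_map_map_eq, map_map]
    exact this
  have hj' : Cont (dual ξ) (T (dual τ)) j := fun H g hH => T_le _ _ _ (hj H g hH)
  have := hF (j f) (map j G) (cont_T hj' G f hG)
  rw [show F = map id F from map_id.symm, prod_map_map_eq, map_map] at this
  exact this

theorem Epi_le_EpiT (ξ : ConvStr X) : Epi ξ ≤ EpiT ξ := by
  intro F x hF
  rw [lim_EpiT] at hF
  exact lim_Epi.2 fun f G hG => hF f G (T_le _ _ _ hG)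

theorem isTDual_iff {ξ : ConvStr X} : IsTDual ξ ↔ EpiT ξ ≤ ξ := by
  have swap : ∀ (G : Filter (Maps ξ sierp)) (F : Filter X),
      map (fun p : Maps ξ sierp × X => p.1.1 p.2) (G ×ˢ F) =
        map (fun p : X × Maps ξ sierp => p.2.1 p.1) (F ×ˢ G) := fun G F => by
    rw [prod_comm, map_map]
    rfl
  constructor
  · intro h F x hF
    rw [lim_EpiT]
    intro f G hG
    rw [← (show dual ξ = T (dual ξ) from h)] at hG
    rw [swap]
    exact hG x F hF
  · intro h
    refine le_antisymm (fun G f hG x F hF => ?_) (T_le _)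
    rw [← swap]
    exact lim_EpiT.1 (h F x hF) f G hG

theorem iterEpiT_zero (ξ : ConvStr X) : iterEpiT ξ 0 = ξ := by
  rw [iterEpiT, if_pos rfl]

theorem iterEpiT_of_ne (ξ : ConvStr X) {α : Ordinal.{u}} (hα : α ≠ 0) :
    iterEpiT ξ α = EpiT (⨆ β : Set.Iio α, iterEpiT ξ β.1) := by
  rw [iterEpiT, if_neg hα]

theorem iterEpiT_mono {ξ : ConvStr X} (hξ : IsEpitopological ξ) : Monotone (iterEpiT ξ) := by
  intro α β hαβ
  by_cases hβ : β = 0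
  · rw [le_antisymm hαβ (by simp [hβ])]
  rw [iterEpiT_of_ne ξ hβ]
  by_cases hα : α = 0
  · rw [hα, iterEpiT_zero]
    calc ξ ≤ Epi ξ := hξ.le
      _ ≤ EpiT ξ := Epi_le_EpiT ξ
      _ ≤ _ := EpiT_mono (le_iSup_of_le ⟨0, pos_iff_ne_zero.2 hβ⟩ (iterEpiT_zero ξ).ge)
  · rw [iterEpiT_of_ne ξ hα]
    exact EpiT_mono (iSup_le fun γ => le_iSup_of_le ⟨γ.1, γ.2.trans_le hαβ⟩ le_rfl)

theorem iterEpiT_succ {ξ : ConvStr X} (hξ : IsEpitopological ξ) (α : Ordinal.{u}) :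
    iterEpiT ξ (α + 1) = EpiT (iterEpiT ξ α) := by
  rw [iterEpiT_of_ne ξ (by simp)]
  congr 1
  refine le_antisymm (iSup_le fun γ => iterEpiT_mono hξ (Order.lt_succ_iff.1 ?_))
    (le_iSup_of_le ⟨α, Order.lt_succ α⟩ le_rfl)
  exact γ.2

theorem iterEpiT_stabilizes {ξ : ConvStr X} (hξ : IsEpitopological ξ) :
    {α : Ordinal.{u} | iterEpiT ξ α = iterEpiT ξ (α + 1)}.Nonempty := by
  have h := not_injective_of_ordinal (iterEpiT ξ)
  rw [Function.Injective] at h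
  push Not at h
  obtain ⟨α, β, hαβ, hne⟩ := h
  wlog hlt : α < β generalizing α β
  · exact this β α hαβ.symm hne.symm (lt_of_le_of_ne (not_lt.1 hlt) hne.symm)
  exact ⟨α, le_antisymm (iterEpiT_mono hξ (Order.le_succ α))
    ((iterEpiT_mono hξ (Order.succ_le_of_lt hlt)).trans hαβ.ge)⟩

theorem isLeast_dT {ξ : ConvStr X} (hξ : IsEpitopological ξ) :
    IsLeast {τ : ConvStr X | ξ ≤ τ ∧ IsEpitopological τ ∧ IsTDual τ} (dT ξ) := by
  have hfix : dT ξ = EpiT (dT ξ) :=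
    (csInf_mem (iterEpiT_stabilizes hξ)).trans (iterEpiT_succ hξ _)
  have hd : IsTDual (dT ξ) := isTDual_iff.2 hfix.ge
  refine ⟨⟨?_, ?_, hd⟩, ?_⟩
  · exact (iterEpiT_zero ξ).ge.trans (iterEpiT_mono hξ (by simp))
  · refine hfix.trans ?_
    ext F x
    rw [lim_EpiT, lim_Epi, ← (show dual (dT ξ) = T (dual (dT ξ)) from hd)]
  · rintro τ ⟨hτ, -, hτd⟩
    have : ∀ α, iterEpiT ξ α ≤ τ := by
      intro α
      induction α using WellFoundedLT.induction with
      | ind α ih =>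
        by_cases hα : α = 0
        · rw [hα, iterEpiT_zero]
          exact hτ
        · rw [iterEpiT_of_ne ξ hα]
          exact (EpiT_mono (iSup_le fun β : Set.Iio α => ih β.1 β.2)).trans (isTDual_iff.1 hτd)
    exact this _

end ConvStr

/-- A topology is core compact if for every `x` and every open `O ∋ x` there is an open `U ∋ x`
such that every open cover of `O` has a finite subfamily that covers `U`. -/
def IsCoreCompact {X : Type u} (t : TopologicalSpace X) : Prop :=
  ∀ (x : X) (O : Set X), IsOpen[t] O → x ∈ O →
    ∃ U : Set X, IsOpen[t] U ∧ x ∈ U ∧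
      ∀ S : Set (Set X), (∀ V ∈ S, IsOpen[t] V) → O ⊆ ⋃₀ S →
        ∃ S₀ ⊆ S, S₀.Finite ∧ U ⊆ ⋃₀ S₀

/-- A convergence is a core compact topology. -/
def ConvStr.IsCoreCompactTopological {X : Type u} (ξ : ConvStr X) : Prop :=
  ∃ t : TopologicalSpace X, ξ = ConvStr.ofTop t ∧ IsCoreCompact t

/-!
Write `U ≪ O` (`RelCompact`) when every open cover of `O` has a finite subfamily covering `U`.
Three facts carry the proof.

* An open set of `T[ξ, $]` is Scott open: if it contains the union of a family of open sets, then
  it contains the union of a finite subfamily, because the net of finite unions converges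
  continuously to the whole union (`exists_finite_sUnion_mem`); it is also an upper set.
* If `t` is core compact, each `{W | V ≪ W}` is open in `T[t, $]` (`isOpen_relCompact`). Hence
  `[t, $]` is topological (`isTDual_of_isCoreCompact`). Given an open `𝒪 ∋ U` in `T[t, $]`,
  the first fact yields `V ∈ 𝒪` with `V ≪ U`, and any member of an open cover of `𝒪` containing
  `V` contains `{W | V ≪ W}`; so `T[t, $]` is itself core compact (`isCoreCompact_dual`).
* Conversely, a topology `t` with `[t, $]` topological is core compact: the neighbourhood filter
  of an open set `O` converges to `O`, so each `x ∈ O` has a neighbourhood `U` contained in all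
  members of a Scott open set around `O`, whence `U ≪ O` (`isCoreCompact_of_isTDual`).

If `T[ξ, $]` is core compact, then `[T[ξ, $], $]` is topological by the second fact, and so is
its initial convergence `Epi_T ξ`. From `ξ ≤ Epi_T ξ ≤ d_T ξ` and `T (d_T ξ) ≤ ξ` it follows that
`Epi_T ξ = T (Epi_T ξ) ≤ T (d_T ξ) ≤ ξ`. So `ξ = Epi_T ξ` is topological and `T`-dual, and the
third fact applies.
-/

/-- `U` is relatively compact in `O`: every open cover of `O` has a finite subfamily covering `U`.
For open sets this is the way-below relation `U ≪ O`. -/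
def RelCompact {X : Type u} (t : TopologicalSpace X) (U O : Set X) : Prop :=
  ∀ S : Set (Set X), (∀ V ∈ S, IsOpen[t] V) → O ⊆ ⋃₀ S → ∃ S₀ ⊆ S, S₀.Finite ∧ U ⊆ ⋃₀ S₀

namespace RelCompact

variable {X : Type u} {t : TopologicalSpace X}

theorem mono {U U' O O' : Set X} (h : RelCompact t U O) (hU : U' ⊆ U) (hO : O ⊆ O') :
    RelCompact t U' O' := fun S hS hc =>
  let ⟨S₀, h₁, h₂, h₃⟩ := h S hS (hO.trans hc)
  ⟨S₀, h₁, h₂, hU.trans h₃⟩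

theorem subset {U O : Set X} (h : RelCompact t U O) (hO : IsOpen[t] O) : U ⊆ O := by
  obtain ⟨S₀, h₁, -, h₃⟩ := h {O} (by simpa using hO) (by simp)
  exact h₃.trans (Set.sUnion_subset fun V hV => (h₁ hV).le)

theorem sUnion {A : Set (Set X)} {O : Set X} (hA : A.Finite) (h : ∀ U ∈ A, RelCompact t U O) :
    RelCompact t (⋃₀ A) O := by
  intro S hS hc
  choose! B hB hfin hcov using fun U hU => h U hU S hS hc
  refine ⟨⋃ U ∈ A, B U, Set.iUnion₂_subset hB, hA.biUnion hfin, Set.sUnion_subset fun U hU => ?_⟩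
  exact (hcov U hU).trans (Set.sUnion_subset_sUnion (Set.subset_biUnion_of_mem hU))

end RelCompact

namespace ConvStr

variable {X : Type u} {Y : Type v}

theorem toTop_ofTop (t : TopologicalSpace X) : (ofTop t).toTop = t := by
  ext O
  constructor
  · intro h
    exact isOpen_iff_mem_nhds.2 fun x hx => h (𝓝 x) x le_rfl hx
  · intro h F x hF hx
    exact hF (h.mem_nhds hx)

theorem T_ofTop (t : TopologicalSpace X) : T (ofTop t) = ofTop t := by
  rw [T, toTop_ofTop]

theorem T_mono {ξ τ : ConvStr X} (h : ξ ≤ τ) : T ξ ≤ T τ := by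
  intro F x hF
  refine (@le_nhds_iff X ξ.toTop _ _).2 fun s hx hs => ?_
  exact (@le_nhds_iff X τ.toTop _ _).1 hF s hx fun G y hG hy => hs G y (h G y hG) hy

theorem initial_ofTop (f : X → Y) (t : TopologicalSpace Y) :
    initial f (ofTop t) = ofTop (t.induced f) := by
  ext F x
  change map f F ≤ 𝓝 (f x) ↔ F ≤ @nhds X (t.induced f) x
  rw [nhds_induced, map_le_iff_le_comap]

theorem lim_sierp {H : Filter Prop} {p : Prop} : sierp.Lim H p ↔ (p → ∀ᶠ q in H, q) := by
  change H ≤ 𝓝 p ↔ _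
  by_cases hp : p
  · have : ({True} : Set Prop) = {q | q} := by
      ext q
      simp
    simp [hp, Filter.Eventually, this]
  · simp [hp]

theorem cont_sierp_iff {ξ : ConvStr X} {f : X → Prop} :
    Cont ξ sierp f ↔ IsOpen[ξ.toTop] {x | f x} :=
  forall_congr' fun _ => forall_congr' fun _ => forall_congr' fun _ => lim_sierp

theorem isOpen_of_ofTop {t : TopologicalSpace X} (f : Maps (ofTop t) sierp) :
    IsOpen[t] {x | f.1 x} := by
  have h := cont_sierp_iff.1 f.2
  rwa [toTop_ofTop] at h

/-- An open set as a continuous map to the Sierpiński space. -/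
def ofOpen {ξ : ConvStr X} (U : Set X) (hU : IsOpen[ξ.toTop] U) : Maps ξ sierp :=
  ⟨fun x => x ∈ U, cont_sierp_iff.2 hU⟩

theorem lim_dual {ξ : ConvStr X} {F : Filter (Maps ξ sierp)} {f : Maps ξ sierp} :
    (dual ξ).Lim F f ↔ ∀ x G, ξ.Lim G x → f.1 x → ∀ᶠ p in G ×ˢ F, p.2.1 p.1 :=
  forall_congr' fun _ => forall_congr' fun _ => forall_congr' fun _ => lim_sierp

/-- Open sets of `T[ξ, $]` are upper sets. -/
theorem mem_of_le_of_isOpen_dual {ξ : ConvStr X} {𝒪 : Set (Maps ξ sierp)}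
    (h𝒪 : IsOpen[(dual ξ).toTop] 𝒪) {f g : Maps ξ sierp} (hf : f ∈ 𝒪) (hfg : ∀ x, f.1 x → g.1 x) :
    g ∈ 𝒪 := by
  -- The principal filter at the larger set `g` converges to `f`.
  refine h𝒪 (pure g) f (lim_dual.2 fun x G hG hx => ?_) hf
  rw [prod_pure, eventually_map]
  exact cont_sierp_iff.1 g.2 G x hG (hfg x hx)

/-- Open sets of `T[ξ, $]` are inaccessible by directed unions: the net of unions of finite
subfamilies of `S` converges to `⋃₀ S` in `[ξ, $]`. -/
theorem exists_finite_sUnion_mem {ξ : ConvStr X} {𝒪 : Set (Maps ξ sierp)}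
    (h𝒪 : IsOpen[(dual ξ).toTop] 𝒪) {f : Maps ξ sierp} (hf : f ∈ 𝒪) {S : Set (Set X)}
    (hS : ∀ V ∈ S, IsOpen[ξ.toTop] V) (hfS : {x | f.1 x} ⊆ ⋃₀ S) :
    ∃ S₀ ⊆ S, S₀.Finite ∧ ∀ g : Maps ξ sierp, (∀ x ∈ ⋃₀ S₀, g.1 x) → g ∈ 𝒪 := by
  classical
  let u : Finset S → Maps ξ sierp := fun A =>
    ofOpen (⋃₀ (Subtype.val '' (A : Set S))) <|
      @isOpen_sUnion X ξ.toTop _ (by rintro _ ⟨V, -, rfl⟩; exact hS V.1 V.2)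
  have hu : (dual ξ).Lim (map u atTop) f := by
    refine lim_dual.2 fun x G hG hx => ?_
    obtain ⟨V, hV, hxV⟩ := hfS hx
    have h₁ : ∀ᶠ y in G, y ∈ V := hS V hV G x hG hxV
    have h₂ : ∀ᶠ g in map u atTop, ∀ y ∈ V, g.1 y := by
      rw [eventually_map]
      filter_upwards [eventually_ge_atTop {(⟨V, hV⟩ : S)}] with A hA y hy
      exact ⟨V, ⟨⟨V, hV⟩, hA (Finset.mem_singleton_self _), rfl⟩, hy⟩
    exact (h₁.prod_mk h₂).mono fun p hp => hp.2 p.1 hp.1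
  obtain ⟨A, hA⟩ : ∃ A, u A ∈ 𝒪 :=
    (eventually_map.1 (h𝒪 _ f hu hf : ∀ᶠ g in map u atTop, g ∈ 𝒪)).exists
  refine ⟨Subtype.val '' (A : Set S), by rintro _ ⟨V, -, rfl⟩; exact V.2,
    A.finite_toSet.image _, fun g hg => mem_of_le_of_isOpen_dual h𝒪 hA hg⟩

/-- The neighbourhoods `{W | V ≪ W}` in `T[t, $]`. Interpolation of `≪` is not needed separately:
core compactness is applied inside the neighbourhoods provided by continuous convergence. -/
theorem isOpen_relCompact {t : TopologicalSpace X} (ht : IsCoreCompact t) (V : Set X) :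
    IsOpen[(dual (ofTop t)).toTop] {g | RelCompact t V {x | g.1 x}} := by
  intro F f hF hV
  -- Each `x ∈ f` has an open `M ≪ g` valid for all `g` far along `F`; finitely many such `M`
  -- cover `V`.
  let S : Set (Set X) :=
    {M | IsOpen[t] M ∧ ∀ᶠ g : Maps (ofTop t) sierp in F, RelCompact t M {x | g.1 x}}
  have hcov : {x | f.1 x} ⊆ ⋃₀ S := by
    intro x hx
    have h := lim_dual.1 hF x (𝓝 x) le_rfl hx
    obtain ⟨pa, hpa, pb, hpb, hp⟩ := eventually_prod_iff.1 h
    obtain ⟨N, hN, hNo, hxN⟩ := eventually_nhds_iff.1 hpa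
    obtain ⟨M, hMo, hxM, hMN⟩ := ht x N hNo hxN
    exact ⟨M, ⟨hMo, hpb.mono fun g hg =>
      RelCompact.mono hMN subset_rfl fun y hy => hp (hN y hy) hg⟩, hxM⟩
  obtain ⟨S₀, hS₀, hfin, hVS⟩ := hV S (fun M hM => hM.1) hcov
  have := (hfin.eventually_all (l := F)).2 fun M hM => (hS₀ hM).2
  filter_upwards [this] with g hg
  exact (RelCompact.sUnion hfin hg).mono hVS subset_rfl

theorem isTDual_of_isCoreCompact {t : TopologicalSpace X} (ht : IsCoreCompact t) :
    IsTDual (ofTop t) := by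
  refine le_antisymm (fun F f hF => lim_dual.2 fun x G hG hx => ?_) (T_le _)
  obtain ⟨V, hV, hxV, hVf⟩ := ht x _ (isOpen_of_ofTop f) hx
  have h₁ : ∀ᶠ y in G, y ∈ V := hG (hV.mem_nhds hxV)
  have h₂ : ∀ᶠ g : Maps (ofTop t) sierp in F, RelCompact t V {x | g.1 x} :=
    (@le_nhds_iff _ (dual (ofTop t)).toTop _ _).1 hF _ hVf (isOpen_relCompact ht V)
  exact (h₁.prod_mk h₂).mono fun p hp => RelCompact.subset hp.2 (isOpen_of_ofTop p.2) hp.1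

theorem isCoreCompact_dual {t : TopologicalSpace X} (ht : IsCoreCompact t) :
    IsCoreCompact (dual (ofTop t)).toTop := by
  intro f 𝒪 h𝒪 hf
  obtain ⟨S₀, hS₀, hfin, h⟩ := exists_finite_sUnion_mem h𝒪 hf
    (S := {V | IsOpen[t] V ∧ RelCompact t V {x | f.1 x}})
    (fun V hV => by rw [toTop_ofTop]; exact hV.1)
    (fun x hx => let ⟨V, hV, hxV, hVf⟩ := ht x _ (isOpen_of_ofTop f) hx; ⟨V, ⟨hV, hVf⟩, hxV⟩)
  have hV : IsOpen[t] (⋃₀ S₀) := isOpen_sUnion fun V hV => (hS₀ hV).1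
  refine ⟨{g | RelCompact t (⋃₀ S₀) {x | g.1 x}}, isOpen_relCompact ht _,
    RelCompact.sUnion hfin fun V hV => (hS₀ hV).2, fun 𝒮 h𝒮 hc => ?_⟩
  -- A member of the cover containing the point `⋃₀ S₀` contains everything above it.
  let v : Maps (ofTop t) sierp := ofOpen (⋃₀ S₀) (by rw [toTop_ofTop]; exact hV)
  obtain ⟨𝒰, h𝒰, hv⟩ := hc (h v fun x hx => hx)
  refine ⟨{𝒰}, by simpa using h𝒰, Set.finite_singleton _, fun g hg => ?_⟩
  exact ⟨𝒰, rfl, mem_of_le_of_isOpen_dual (h𝒮 _ h𝒰) hv (RelCompact.subset hg (isOpen_of_ofTop g))⟩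

theorem isCoreCompact_of_isTDual {t : TopologicalSpace X} (ht : IsTDual (ofTop t)) :
    IsCoreCompact t := by
  intro x O hO hx
  let f : Maps (ofTop t) sierp := ofOpen O (by rw [toTop_ofTop]; exact hO)
  have hlim : (dual (ofTop t)).Lim (@nhds _ (dual (ofTop t)).toTop f) f :=
    le_of_eq ht _ _ (le_refl (@nhds _ (dual (ofTop t)).toTop f))
  obtain ⟨pa, hpa, pb, hpb, hp⟩ := eventually_prod_iff.1 (lim_dual.1 hlim x (𝓝 x) le_rfl hx)
  obtain ⟨U, hU, hUo, hxU⟩ := eventually_nhds_iff.1 hpa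
  obtain ⟨𝒪, h𝒪, h𝒪o, hf⟩ := (@eventually_nhds_iff _ (dual (ofTop t)).toTop _ _).1 hpb
  refine ⟨U, hUo, hxU, fun S hS hc => ?_⟩
  obtain ⟨S₀, hS₀, hfin, h⟩ := exists_finite_sUnion_mem h𝒪o hf
    (fun V hV => by rw [toTop_ofTop]; exact hS V hV) hc
  have hV : IsOpen[(ofTop t).toTop] (⋃₀ S₀) := by
    rw [toTop_ofTop]
    exact isOpen_sUnion fun V hV => hS V (hS₀ hV)
  exact ⟨S₀, hS₀, hfin, fun y hy => hp (hU y hy) (h𝒪 _ (h (ofOpen _ hV) fun z hz => hz))⟩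

/-- `Epi_T ξ` is topological if `T[ξ, $]` is core compact. -/
theorem exists_EpiT_eq_ofTop {ξ : ConvStr X} (h : IsCoreCompact ξ.dual.toTop) :
    ∃ t, EpiT ξ = ofTop t := by
  have hd : dual (T (dual ξ)) = T (dual (T (dual ξ))) := isTDual_of_isCoreCompact h
  exact ⟨_, (congrArg (initial (bidualMapT ξ)) hd).trans (initial_ofTop _ _)⟩

theorem EpiT_le_dT {ξ : ConvStr X} (hξ : IsEpitopological ξ) : EpiT ξ ≤ dT ξ :=
  let ⟨hle, _, hd⟩ := (isLeast_dT hξ).1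
  (EpiT_mono hle).trans (isTDual_iff.1 hd)

end ConvStr

open ConvStr in
theorem mainTheorem4 {X : Type u} (ξ : ConvStr X) (hξ : ξ.IsEpitopological)
    (h : ConvStr.T ξ.dT ≤ ξ) :
    IsCoreCompact ξ.dual.toTop ↔ ξ.IsCoreCompactTopological := by
  constructor
  · intro hc
    obtain ⟨t, ht⟩ := exists_EpiT_eq_ofTop hc
    have hle : EpiT ξ ≤ ξ := by
      calc EpiT ξ = T (EpiT ξ) := by rw [ht, T_ofTop]
        _ ≤ T ξ.dT := T_mono (EpiT_le_dT hξ)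
        _ ≤ ξ := h
    have heq : ξ = ofTop t := ht ▸ le_antisymm (hξ.le.trans (Epi_le_EpiT ξ)) hle
    exact ⟨t, heq, isCoreCompact_of_isTDual (heq ▸ isTDual_iff.2 hle)⟩
  · rintro ⟨t, rfl, ht⟩
    exact isCoreCompact_dual ht
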